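/- Let $\{a,b\}^*$ be the set of words over the two letters $a,b$, and write $|w|$ for the length of a word $w$. The right palindromic closure $u^{(+)}$ of a word $u$ is the shortest palindrome having $u$ as a prefix, and $\psi:\{a,b\}^*\to\{a,b\}^*$ is defined by $\psi(\varepsilon)=\varepsilon$ and $\psi(vx)=(\psi(v)x)^{(+)}$ for every word $v$ and letter $x$. For coprime positive integers $p,q$ and $N=p+q$, the Christoffel word of slope $p/q$ is $x_1\cdots x_N$, where $x_i=a$ if $(ip \bmod N)>((i-1)p\bmod N)$ and $x_i=b$ if $(ip \bmod N)<((i-1)p\bmod N)$; these are the proper Christoffel words. The integral representation of a word $v$ is the sequence $(\alpha_0,\dots,\alpha_n)$, $n\ge 0$, of integers with $\alpha_0\ge 0$, $\alpha_i>0$ for $1\le i\le n$ and $$v=b^{\alpha_0}a^{\alpha_1}b^{\alpha_2}a^{\alpha_3}\cdots x^{\alpha_n},$$ where $x=b$ if $n$ is even and $x=a$ if $n$ is odd (in particular, the empty word has the representation $(0)$). Continuants are defined by $K[\,]=1$, $K[c_0]=c_0$ and $K[c_0,\dots,c_m]=c_mK[c_0,\dots,c_{m-1}]+K[c_0,\dots,c_{m-2}]$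 for $m\ge 1$. **Theorem.** Let $w=a\psi(v)b$ be a proper Christoffel word, and let $(\alpha_0,\alpha_1,\dots,\alpha_n)$, $n\ge 0$, be the integral representation of $v$. Then $$|w|=K[\alpha_0+1,\alpha_1,\dots,\alpha_{n-1},\alpha_n+1],$$ where for $n=0$ the right-hand side is read as $K[\alpha_0+2]$ (which equals $K[\alpha_0+1,1]$). -/

import Mathlib

/-- The binary alphabet `{a, b}`. Words over it are lists of letters. -/
inductive Letter : Type
  | a : Letter
  | b : Letter
  deriving DecidableEq

namespace Letter

/-- The right palindromic closure of `w`. Leading letters are stripped off until what remains is a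
palindrome (the longest palindromic suffix `Q` of `w = uQ`), giving `u Q u~`. By
`palClosure_isShortest` below this is the unique shortest palindrome having `w` as a prefix. -/
def palClosure : List Letter → List Letter
  | [] => []
  | x :: w => if (x :: w).reverse = x :: w then x :: w else x :: (palClosure w ++ [x])

/-- `palClosure w` is a palindrome with prefix `w`, and every other palindrome with prefix `w` is
strictly longer. -/
theorem palClosure_isShortest (w : List Letter) :
    (palClosure w).Palindrome ∧ w <+: palClosure w ∧
      ∀ p : List Letter, p.Palindrome → w <+: p → p ≠ palClosure w →
        (palClosure w).length < p.length := by
  induction w with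
  | nil =>
    refine ⟨List.Palindrome.nil, List.prefix_rfl, fun p _ _ hp => ?_⟩
    simpa [palClosure, List.length_pos_iff] using hp
  | cons x w ih =>
    obtain ⟨h1, h2, h3⟩ := ih
    by_cases hx : (x :: w).reverse = x :: w
    · simp only [palClosure, if_pos hx]
      refine ⟨List.Palindrome.of_reverse_eq hx, List.prefix_rfl, fun p _ hwp hp => ?_⟩
      refine lt_of_le_of_ne hwp.length_le fun h => hp (hwp.eq_of_length h).symm
    · simp only [palClosure, if_neg hx]
      refine ⟨List.Palindrome.cons_concat x h1, ?_, fun p hpal hwp hp => ?_⟩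
      · exact (List.prefix_cons_inj x).2 (h2.trans (List.prefix_append _ _))
      · cases hpal with
        | nil => simp at hwp
        | singleton y =>
          obtain ⟨t, ht⟩ := hwp
          simp at ht
          simp [ht.2.1] at hx
        | @cons_concat y l hl =>
          obtain ⟨rfl, hwl⟩ := List.cons_prefix_cons.1 hwp
          rcases List.prefix_concat_iff.1 hwl with h | h
          · refine absurd ?_ hx
            rw [h]
            simp [hl.reverse_eq]
          · have := h3 l hl h (fun h => hp (by rw [h]))
            simpa using this

/-- The palindromization map `ψ`: `ψ(ε) = ε` and `ψ(vx) = (ψ(v)x)^(+)`. -/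
def psi (v : List Letter) : List Letter :=
  v.foldl (fun u x => palClosure (u ++ [x])) []

/-- The Christoffel word of slope `p / q`: with `n = p + q`, its `i`-th letter, `1 ≤ i ≤ n`, is `a`
if `(i - 1) p mod n < i p mod n`, and `b` otherwise (here `i` runs from `0` to `n - 1`). For
`p, q` positive and coprime the two remainders always differ. -/
def christoffelWord (p q : ℕ) : List Letter :=
  (List.range (p + q)).map fun i =>
    if (i * p) % (p + q) < ((i + 1) * p) % (p + q) then a else b

/-- Proper Christoffel words: those of slope `p / q` with `p, q` positive and coprime. -/
def IsProperChristoffel (w : List Letter) : Prop :=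
  ∃ p q : ℕ, 0 < p ∧ 0 < q ∧ Nat.Coprime p q ∧ w = christoffelWord p q

/-- `(α₀, α₁, …, αₙ)` is the integral representation of `v`: `v = b^α₀ a^α₁ b^α₂ ⋯`, the letters
alternating and ending with the `αₙ`-th power of `b` or of `a` according to the parity of `n`,
where `α₀ ≥ 0` and `αᵢ > 0` for `1 ≤ i ≤ n`. The empty word is represented by `(0)`. -/
def IsIntegralRep (v : List Letter) {n : ℕ} (α : Fin (n + 1) → ℕ) : Prop :=
  (∀ i, i ≠ 0 → 0 < α i) ∧
    v = (List.ofFn fun i : Fin (n + 1) =>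
      List.replicate (α i) (if Even (i : ℕ) then b else a)).flatten

end Letter

/-- The continuant `K[c₀, …, cₙ₋₁]` of a finite sequence of length `n`:
`K[] = 1`, `K[c₀] = c₀`, and
`K[c₀, …, cₙ₊₁] = cₙ₊₁ K[c₀, …, cₙ] + K[c₀, …, cₙ₋₁]`. -/
def continuant : (n : ℕ) → (Fin n → ℕ) → ℕ
  | 0, _ => 1
  | 1, c => c 0
  | n + 2, c => c (Fin.last (n + 1)) * continuant (n + 1) (Fin.init c) +
      continuant n (Fin.init (Fin.init c))

namespace Letter

/-! For a palindrome `u`, the closure of `ux` has length `2|ux| - k`, with `k` the length of the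
longest palindromic suffix of `ux`. Reversing `u`, this `k` is the mark of `x` (`IsMark`). Passing
to the closure makes the mark of `x` equal to `|u| + 2` and preserves that of the other letter.
Hence the two marks sum to `|ψ(v)| + 2 = |w|` and evolve by `periodStep` (`psi_invariant`). A block
of equal letters adds a multiple of one mark to the other, which is the continuant recursion
(`foldl_periodStep_blocks`). -/

theorem exists_palindrome_suffix_palClosure (w : List Letter) :
    ∃ T S : List Letter, S.Palindrome ∧ w = T ++ S ∧ palClosure w = T ++ S ++ T.reverse := by
  induction w with
  | nil => exact ⟨[], [], .nil, rfl, rfl⟩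
  | cons x w ih =>
    by_cases hx : (x :: w).reverse = x :: w
    · exact ⟨[], x :: w, .of_reverse_eq hx, rfl, by simp only [palClosure, if_pos hx]; simp⟩
    · obtain ⟨T, S, hS, h1, h2⟩ := ih
      refine ⟨x :: T, S, hS, by simp [h1], ?_⟩
      simp only [palClosure, if_neg hx, h2]
      simp

theorem length_palClosure_add_le {T S : List Letter} (hS : S.Palindrome) :
    (palClosure (T ++ S)).length ≤ T.length + S.length + T.length := by
  have hp : (T ++ S ++ T.reverse).Palindrome :=
    .of_reverse_eq (by simp [hS.reverse_eq])
  by_cases h : T ++ S ++ T.reverse = palClosure (T ++ S)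
  · rw [← h]; simp [add_assoc]
  · have := (palClosure_isShortest (T ++ S)).2.2 _ hp (List.prefix_append _ _) h
    simp at this
    omega

/-- `k` is two more than the length of the longest palindromic prefix of `u` which is followed
by the letter `x` in `u`, and `k = 1` if there is none. -/
def IsMark (u : List Letter) (x : Letter) (k : ℕ) : Prop :=
  ((∃ Q : List Letter, Q.Palindrome ∧ Q ++ [x] <+: u ∧ k = Q.length + 2) ∨ k = 1) ∧
    ∀ Q : List Letter, Q.Palindrome → Q ++ [x] <+: u → Q.length + 2 ≤ k

/-- A palindromic suffix of `ux` of length at least 2 is `xQx` with `Q` a palindrome; as `u` is a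
palindrome, its suffix `xQ` mirrors to a prefix `Qx`. The value `k = 1` stands for the suffix `x`
alone. -/
theorem IsMark.length_palClosure {u : List Letter} (hu : u.Palindrome) {x : Letter} {k : ℕ}
    (hk : IsMark u x k) : (palClosure (u ++ [x])).length + k = 2 * (u.length + 1) := by
  apply le_antisymm
  · obtain ⟨⟨Q, hQ, ⟨R, hR⟩, rfl⟩ | rfl, -⟩ := hk
    · have hu' : u = R.reverse ++ ([x] ++ Q) := by
        rw [← hu.reverse_eq, ← hR]
        simp [hQ.reverse_eq]
      have hS : (x :: (Q ++ [x])).Palindrome := .cons_concat x hQ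
      have h := length_palClosure_add_le (T := R.reverse) hS
      have h2 : u ++ [x] = R.reverse ++ (x :: (Q ++ [x])) := by rw [hu']; simp
      have h3 := congrArg List.length hu'
      rw [h2]
      simp at h h3 ⊢
      omega
    · have h := length_palClosure_add_le (T := u) (List.Palindrome.singleton x)
      simp at h
      omega
  · obtain ⟨T, S, hS, h1, h2⟩ := exists_palindrome_suffix_palClosure (u ++ [x])
    have hl := congrArg List.length h1
    have hk1 : 1 ≤ k := by
      obtain ⟨⟨Q, -, -, rfl⟩ | rfl, -⟩ := hk <;> omega
    have hSk : S.length ≤ k := by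
      cases hS with
      | nil => simp
      | singleton y => simpa using hk1
      | @cons_concat y Q hQ =>
        have h3 : u ++ [x] = (T ++ (y :: Q)) ++ [y] := by rw [h1]; simp
        obtain ⟨h4, h5⟩ := List.append_inj' h3 rfl
        obtain rfl : x = y := by simpa using h5
        have := hk.2 Q hQ ⟨T.reverse, by
          rw [← hu.reverse_eq, h4]; simp [hQ.reverse_eq]⟩
        simp; omega
    rw [h2]
    simp at hl ⊢
    omega

/-- A longer `Q` would have `ux` as a prefix and be a proper prefix of the closure, against
minimality. -/
theorem prefix_of_palindrome_prefix_palClosure {u Q : List Letter} {x z : Letter}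
    (hQ : Q.Palindrome) (h : Q ++ [z] <+: palClosure (u ++ [x])) : Q <+: u := by
  have hc := palClosure_isShortest (u ++ [x])
  have hlt : Q.length < (palClosure (u ++ [x])).length := by
    have := h.length_le
    simp at this
    omega
  have hQp : Q <+: palClosure (u ++ [x]) := (List.prefix_append _ _).trans h
  rcases le_total (u ++ [x]).length Q.length with hle | hle
  · have h1 := List.prefix_of_prefix_length_le hc.2.1 hQp hle
    by_cases he : Q = palClosure (u ++ [x])
    · rw [← he] at hlt
      omega
    · have := hc.2.2 Q hQ h1 he
      omega
  · have h1 := List.prefix_of_prefix_length_le hQp hc.2.1 hle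
    rcases List.prefix_concat_iff.1 h1 with h2 | h2
    · have h3 := hc.2.2 Q hQ (by rw [h2]) (by rintro h4; rw [← h4] at hlt; omega)
      omega
    · exact h2

theorem IsMark.palClosure_self {u : List Letter} (hu : u.Palindrome) (x : Letter) :
    IsMark (palClosure (u ++ [x])) x (u.length + 2) := by
  refine ⟨Or.inl ⟨u, hu, (palClosure_isShortest _).2.1, rfl⟩, fun Q hQ h => ?_⟩
  have := (prefix_of_palindrome_prefix_palClosure hQ h).length_le
  omega

theorem IsMark.palClosure_of_ne {u : List Letter} {x y : Letter} (hxy : y ≠ x)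
    {k : ℕ} (hk : IsMark u y k) : IsMark (palClosure (u ++ [x])) y k := by
  have hpre := (palClosure_isShortest (u ++ [x])).2.1
  refine ⟨?_, fun Q hQ h => ?_⟩
  · obtain ⟨⟨Q, hQ, h, rfl⟩ | rfl, -⟩ := hk
    · exact Or.inl ⟨Q, hQ, (h.trans (List.prefix_append _ _)).trans hpre, rfl⟩
    · exact Or.inr rfl
  · apply hk.2 Q hQ
    have hle := (prefix_of_palindrome_prefix_palClosure hQ h).length_le
    have h1 : Q ++ [y] <+: u ++ [x] :=
      List.prefix_of_prefix_length_le h hpre (by simpa using hle)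
    rcases List.prefix_concat_iff.1 h1 with h2 | h2
    · exact absurd (by simpa using (List.append_inj' h2 rfl).2) hxy
    · exact h2

/-- The pair of minimal periods of `ψ(v)` whose sum is `|ψ(v)| + 2`, computed letter by letter. -/
def periodStep (s : ℕ × ℕ) : Letter → ℕ × ℕ
  | a => (s.1, s.2 + s.1)
  | b => (s.1 + s.2, s.2)

theorem psi_invariant (v : List Letter) :
    (psi v).Palindrome ∧ IsMark (psi v) a (v.foldl periodStep (1, 1)).2 ∧
      IsMark (psi v) b (v.foldl periodStep (1, 1)).1 ∧
      (psi v).length + 2 = (v.foldl periodStep (1, 1)).1 + (v.foldl periodStep (1, 1)).2 := by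
  induction v using List.reverseRecOn with
  | nil =>
    refine ⟨.nil, ⟨Or.inr rfl, ?_⟩, ⟨Or.inr rfl, ?_⟩, rfl⟩ <;>
    · intro Q _ h
      simp [psi] at h
  | append_singleton v x ih =>
    obtain ⟨hp, ha, hb, hl⟩ := ih
    have hpsi : psi (v ++ [x]) = palClosure (psi v ++ [x]) := by simp [psi]
    rw [hpsi, List.foldl_append, List.foldl_cons, List.foldl_nil]
    generalize v.foldl periodStep (1, 1) = s at *
    refine ⟨(palClosure_isShortest _).1, ?_⟩
    cases x
    -- The new length plus 2 is `2 * (s.1 + s.2) - s.2`, the sum of the new marks `s.1` and `s.1 +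
    -- s.2`.
    · have := ha.length_palClosure hp
      have hs := IsMark.palClosure_self hp a
      refine ⟨?_, hb.palClosure_of_ne (by decide), ?_⟩
      · rw [hl, add_comm] at hs
        exact hs
      · simp only [periodStep]
        omega
    · have := hb.length_palClosure hp
      have hs := IsMark.palClosure_self hp b
      refine ⟨ha.palClosure_of_ne (by decide), ?_, ?_⟩
      · rw [hl] at hs
        exact hs
      · simp only [periodStep]
        omega

theorem foldl_periodStep_replicate_a (k : ℕ) (s : ℕ × ℕ) :
    (List.replicate k a).foldl periodStep s = (s.1, k * s.1 + s.2) := by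
  induction k generalizing s with
  | zero => simp
  | succ k ih =>
    rw [List.replicate_succ, List.foldl_cons, ih]
    simp only [periodStep, Prod.mk.injEq, true_and]
    ring

theorem foldl_periodStep_replicate_b (k : ℕ) (s : ℕ × ℕ) :
    (List.replicate k b).foldl periodStep s = (k * s.2 + s.1, s.2) := by
  induction k generalizing s with
  | zero => simp
  | succ k ih =>
    rw [List.replicate_succ, List.foldl_cons, ih]
    simp only [periodStep, Prod.mk.injEq, and_true]
    ring

/-- The coordinate updated by the last block, chosen by parity, holds the newest continuant and the
other its predecessor. The start `(1, 1)` produces the `+ 1` on `α 0`. -/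
theorem foldl_periodStep_blocks (n : ℕ) (α : Fin (n + 1) → ℕ) :
    (List.ofFn fun i : Fin (n + 1) =>
        List.replicate (α i) (if Even (i : ℕ) then b else a)).flatten.foldl periodStep (1, 1) =
      let c : Fin (n + 1) → ℕ := fun i => α i + if i = 0 then 1 else 0
      if Even n then (continuant (n + 1) c, continuant n (Fin.init c))
      else (continuant n (Fin.init c), continuant (n + 1) c) := by
  induction n with
  | zero => simp [foldl_periodStep_replicate_b, continuant]
  | succ n ih =>
    rw [List.ofFn_succ', List.concat_eq_append, List.flatten_append, List.foldl_append]
    have h := ih fun i => α i.castSucc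
    simp only [Fin.val_castSucc, Fin.val_last, List.flatten_singleton] at h ⊢
    rw [h]
    have hc : (Fin.init fun i : Fin (n + 2) => α i + if i = 0 then 1 else 0) =
        fun i : Fin (n + 1) => α i.castSucc + if i = 0 then 1 else 0 := by
      funext i
      simp [Fin.init]
    have h0 : Fin.last (n + 1) ≠ 0 := (Fin.last_pos).ne'
    by_cases hn : Even n
    · simp [hn, Nat.even_add_one, foldl_periodStep_replicate_a, continuant, hc, h0]
    · simp [hn, Nat.even_add_one, foldl_periodStep_replicate_b, continuant, hc, h0]

end Letter

/-- A continuant is affine in its last entry, with slope the continuant of the preceding entries.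
This turns the sum of the two marks into a single continuant. -/
theorem continuant_add_one_last (n : ℕ) (c : Fin (n + 1) → ℕ) :
    continuant (n + 1) (fun i => c i + if i = Fin.last n then 1 else 0) =
      continuant (n + 1) c + continuant n (Fin.init c) := by
  cases n with
  | zero => simp [continuant]
  | succ n =>
    have hc : (Fin.init fun i : Fin (n + 2) => c i + if i = Fin.last (n + 1) then 1 else 0) =
        Fin.init c := by
      funext i
      simp [Fin.init, (Fin.castSucc_lt_last i).ne]
    simp only [continuant, hc, if_true]
    ring

theorem theorem5p2 (w v : List Letter) (hw : Letter.IsProperChristoffel w)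
    (hwv : w = [Letter.a] ++ Letter.psi v ++ [Letter.b])
    (n : ℕ) (α : Fin (n + 1) → ℕ) (hα : Letter.IsIntegralRep v α) :
    w.length = continuant (n + 1)
      (fun i => α i + (if i = 0 then 1 else 0) + (if i = Fin.last n then 1 else 0)) := by
  rw [continuant_add_one_last n fun i => α i + if i = 0 then 1 else 0]
  have hl := (Letter.psi_invariant v).2.2.2
  have hf := Letter.foldl_periodStep_blocks n α
  rw [← hα.2] at hf
  have hw' : w.length = (Letter.psi v).length + 2 := by simp [hwv]
  rw [hw', hl, hf]
  split_ifs
  · rfl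
  · exact add_comm _ _
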